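/- A normalized Gaussian tree $T$ on a finite vertex set $V$ is a tree with vertex set $V$ whose edges $e$ carry weights $w_e\in(-1,1)$. Its covariance matrix $\Sigma_T$ has the entry $1$ at $(u,u)$, and for $u\neq v$ the entry at $(u,v)$ is the product of the weights along the path from $u$ to $v$. For positive definite $N\times N$ matrices put $$D(\Sigma_1\|\Sigma_2)=\tfrac12\log\frac{|\Sigma_2|}{|\Sigma_1|}+\tfrac12\operatorname{tr}(\Sigma_2^{-1}\Sigma_1)-\tfrac N2,\qquad \Sigma_\lambda^{-1}=\lambda\Sigma_1^{-1}+(1-\lambda)\Sigma_2^{-1}.$$ The Chernoff information of two Gaussian trees with covariance matrices $\Sigma_1,\Sigma_2$ is $CI(T_1\|T_2)=D(\Sigma_{\lambda^*}\|\Sigma_1)=D(\Sigma_{\lambda^*}\|\Sigma_2)$, where $\lambda^*\in[0,1]$ is a point at which the last equality holds (it exists, and it is unique if $\Sigma_1\ne\Sigma_2$; if $\Sigma_1=\Sigma_2$ every $\lambda^*\in[0,1]$ gives the value $0$). A grafting operation with anchor nodes $i,p,q$ turns a Gaussian tree into another one by replacing an edge $ip$ by a new edge $iq$, $q\ne p$,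 with the same weight, and keeping all other edges and weights. In a grafting chain $T_1\leftrightarrow T_2\leftrightarrow\dots\leftrightarrow T_n$ $(n\ge1)$ the tree $T_{k+1}$ arises from $T_k$ by a grafting operation with anchor nodes $i_k,p_k,q_k$, for $1\le k<n$. The operations of the chain are independent if $V$ is the disjoint union of nonempty sets $C$ (the center) and $L_1,\dots,L_{n-1}$ (the super leaf nodes) such that, in every tree $T_t$ of the chain, each of these sets induces a connected subgraph and no edge joins two different sets $L_k,L_l$, and such that for every $k$ either $i_k\in L_k$ and $p_k,q_k\in C$, or $i_k\in C$ and $p_k,q_k\in L_k$. Proposition. Let $T_1\leftrightarrow T_2\leftrightarrow\dots\leftrightarrow T_n$ be a grafting chain whose grafting operations are independent. Then $$CI(T_i\|T_j)\le CI(T_p\|T_q)\qquad\text{whenever } 1\le p\le i\le j\le q\le n.$$ Consequently, if $n\ge2$, the minimum of $CI(T_a\|T_b)$ over all pairs $a\ne b$ is attained at an adjacent pair: there is a $k$ with $1\le k<n$ and $CI(T_k\|T_{k+1})\le CI(T_a\|T_b)$ for all $a\neq b$. -/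

import Mathlib

noncomputable section

/-- A normalized Gaussian tree on the vertex set `V`: a tree whose edges carry weights (the
correlations of adjacent variables) of absolute value less than one, so that the covariance
matrix is nonsingular. Only the values of `weight` on edges of the tree matter. -/
structure GaussianTree (V : Type*) where
  graph : SimpleGraph V
  isTree : graph.IsTree
  weight : Sym2 V → ℝ
  abs_weight_lt_one : ∀ e ∈ graph.edgeSet, |weight e| < 1

namespace GaussianTree

variable {V : Type*}

/-- The unique path from `u` to `v`. -/
def path (T : GaussianTree V) (u v : V) : T.graph.Walk u v :=
  (T.isTree.existsUnique_path u v).choose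

/-- The normalized covariance matrix: the entry at `(u, v)` is the product of the edge weights
along the path from `u` to `v`; in particular it is `1` for `u = v`. -/
def cov (T : GaussianTree V) : Matrix V V ℝ :=
  Matrix.of fun u v => ((T.path u v).edges.map T.weight).prod

/-- `T'` arises from `T` by one grafting operation with anchor nodes `i, p, q`: the edge `ip` is
cut, and the subtree on the side of `i` is pasted to another node `q` by a new edge `iq` with the
weight of the cut edge; everything else is kept. (As `T'` is a tree, `q` lies on the side of `p`
of the cut edge.) -/
structure IsGrafting (T T' : GaussianTree V) (i p q : V) : Prop where
  adj : T.graph.Adj i p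
  ne : q ≠ p
  adj' : T'.graph.Adj i q
  edgeSet_eq : T'.graph.edgeSet = T.graph.edgeSet \ {s(i, p)} ∪ {s(i, q)}
  weight_new : T'.weight s(i, q) = T.weight s(i, p)
  weight_old : ∀ e ∈ T.graph.edgeSet, e ≠ s(i, p) → T'.weight e = T.weight e

/-- A grafting chain `T 0 ↔ T 1 ↔ ⋯ ↔ T m`: the `k`-th operation turns `T k` into `T (k + 1)` and
has the anchor nodes `i k, p k, q k`. -/
def IsGraftingChain {m : ℕ} (T : Fin (m + 1) → GaussianTree V) (i p q : Fin m → V) : Prop :=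
  ∀ k : Fin m, IsGrafting (T k.castSucc) (T k.succ) (i k) (p k) (q k)

/-- A star-shaped regrouping of the nodes for the operations of a chain: `part` divides the nodes
into a center (`none`) and disjoint super leaf nodes (`some k`), one for each operation, such that
all the trees of the chain are star-shaped with respect to this grouping, and the `k`-th operation
only moves the edge that joins the `k`-th super leaf node to the center, at one of its ends: either
the super leaf node is cut off and pasted to another place of the center, or the center is cut off
and pasted to another place of the super leaf node.

All that stays fixed is counted to the center. So when a small subtree is cut from
some larger branch and pasted to another place of the same branch or to another branch, its
super leaf node here is the small subtree, and the rest of the branches belongs to the center. -/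
structure IsStarGrouping {m : ℕ} (T : Fin (m + 1) → GaussianTree V) (i p q : Fin m → V)
    (part : V → Option (Fin m)) : Prop where
  /-- The center and the super leaf nodes are (nonempty) subtrees. -/
  connected : ∀ (t : Fin (m + 1)) (c : Option (Fin m)),
    ((T t).graph.induce {v | part v = c}).Connected
  /-- No edge joins two different super leaf nodes. -/
  star : ∀ (t : Fin (m + 1)) (u v : V), (T t).graph.Adj u v →
    part u = part v ∨ part u = none ∨ part v = none
  /-- The `k`-th operation involves no super leaf node but the `k`-th one. -/
  anchors : ∀ k : Fin m,
    (part (i k) = some k ∧ part (p k) = none ∧ part (q k) = none) ∨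
    (part (i k) = none ∧ part (p k) = some k ∧ part (q k) = some k)

/-- The grafting operations of a chain are independent. -/
def IsIndependent {m : ℕ} (T : Fin (m + 1) → GaussianTree V) (i p q : Fin m → V) : Prop :=
  ∃ part : V → Option (Fin m), IsStarGrouping T i p q part

end GaussianTree

namespace Gaussian

variable {V : Type*} [Fintype V] [DecidableEq V]

/-- The Kullback-Leibler distance `D(S₁ ‖ S₂)` of the centered Gaussian distributions with
covariance matrices `S₁` and `S₂`. -/
def klDist (S₁ S₂ : Matrix V V ℝ) : ℝ :=
  1 / 2 * Real.log (S₂.det / S₁.det) + 1 / 2 * (S₂⁻¹ * S₁).trace - (Fintype.card V : ℝ) / 2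

/-- The covariance matrix `S_l` of the exponential family of `S₁` and `S₂`, given by
`S_l⁻¹ = l S₁⁻¹ + (1 - l) S₂⁻¹`. -/
def mix (S₁ S₂ : Matrix V V ℝ) (l : ℝ) : Matrix V V ℝ :=
  (l • S₁⁻¹ + (1 - l) • S₂⁻¹)⁻¹

/-- `l` is an optimal parameter: `l ∈ [0, 1]` and `D(S_l ‖ S₁) = D(S_l ‖ S₂)`. -/
def IsOptimal (S₁ S₂ : Matrix V V ℝ) (l : ℝ) : Prop :=
  l ∈ Set.Icc (0 : ℝ) 1 ∧ klDist (mix S₁ S₂ l) S₁ = klDist (mix S₁ S₂ l) S₂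

/-- The Chernoff information `D(S_l ‖ S₁) = D(S_l ‖ S₂)` at the optimal parameter `l`. For positive
definite `S₁ ≠ S₂` there is exactly one optimal parameter; for `S₁ = S₂` all of `[0, 1]` is
optimal, with the value `0`. -/
def chernoffInfo (S₁ S₂ : Matrix V V ℝ) : ℝ :=
  klDist (mix S₁ S₂ (Classical.epsilon (IsOptimal S₁ S₂))) S₂

end Gaussian

namespace GaussianTree

variable {V : Type*} [Fintype V] [DecidableEq V]

/-- The Chernoff information of two Gaussian trees. -/
def CI (T T' : GaussianTree V) : ℝ :=
  Gaussian.chernoffInfo T.cov T'.cov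

end GaussianTree

end

/-! The Chernoff information is the maximum over l in [0,1] of an exponent that depends only on the
determinants of S₁, S₂ and l S₁⁻¹ + (1 - l) S₂⁻¹ (`chernoffInfo_isGreatest`). For a tree, S⁻¹ is the
identity plus one rank-two term per edge (`info`, `edgeMatrix`), so a grafting exchanges one such
term.

Let the k-th edge be cut in a mixture G of two trees that agree at the super leaf node L. The
columns of G⁻¹ at vertices of L used below are supported in L, with diagonal entry 1. Hence
attaching an edge of weight w from L to the rest multiplies the determinant by the same factor,
wherever it is attached (`det_add_edgeMatrix`). In particular all trees of the chain have equal
determinant.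

Let X and Y be G with the old and with the new edge. If both trees have the old edge, their mixture
is X; if only one is grafted, it is lX + (1 - l)Y. Since X and Y have equal determinant, concavity
of log det shows that grafting increases the determinant weakly (`det_mixture_le_of_move`). Widening
a pair one step at a time gives the monotonicity. -/

namespace Gaussian

/-! ### Gaussian divergence and the variational form of Chernoff information. -/

open Matrix
open scoped MatrixOrder

variable {V : Type*} [Fintype V] [DecidableEq V]

/-- This is log x ≤ x - 1, summed over the eigenvalues. -/
theorem log_det_le_trace_sub_card {A : Matrix V V ℝ} (hA : A.PosDef) :
    Real.log A.det ≤ A.trace - Fintype.card V := by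
  have hpos := hA.eigenvalues_pos
  rw [hA.1.det_eq_prod_eigenvalues, hA.1.trace_eq_sum_eigenvalues]
  simp only [RCLike.ofReal_real_eq_id, id]
  rw [Real.log_prod fun i _ => (hpos i).ne']
  calc ∑ i, Real.log (hA.1.eigenvalues i) ≤ ∑ i, (hA.1.eigenvalues i - 1) :=
        Finset.sum_le_sum fun i _ => Real.log_le_sub_one_of_pos (hpos i)
    _ = _ := by simp

theorem klDist_nonneg {S₁ S₂ : Matrix V V ℝ} (h₁ : S₁.PosDef) (h₂ : S₂.PosDef) :
    0 ≤ klDist S₁ S₂ := by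
  obtain ⟨B, hB⟩ := CStarAlgebra.nonneg_iff_eq_star_mul_self.mp h₁.posSemidef.nonneg
  rw [star_eq_conjTranspose] at hB
  have hdet : S₁.det = B.det * B.det := by rw [hB]; simp
  have hBu : IsUnit B := by
    rw [isUnit_iff_isUnit_det, isUnit_iff_ne_zero]
    intro h
    exact h₁.det_pos.ne' (by rw [hdet, h, zero_mul])
  -- A symmetric stand-in for S₂⁻¹ S₁, with the same trace and determinant.
  have hpd : (B * S₂⁻¹ * Bᴴ).PosDef :=
    h₂.inv.mul_mul_conjTranspose_same (vecMul_injective_iff_isUnit.mpr hBu)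
  have key := log_det_le_trace_sub_card hpd
  have htr : (B * S₂⁻¹ * Bᴴ).trace = (S₂⁻¹ * S₁).trace := by
    rw [hB, Matrix.mul_assoc, Matrix.trace_mul_comm, Matrix.mul_assoc]
  have hdt : (B * S₂⁻¹ * Bᴴ).det = (S₂.det / S₁.det)⁻¹ := by
    rw [hdet]
    simp only [det_mul, det_nonsing_inv, det_conjTranspose, star_trivial, Ring.inverse_eq_inv']
    rw [inv_div]
    ring
  rw [htr, hdt, Real.log_inv] at key
  unfold klDist
  linarith

theorem klDist_self {S : Matrix V V ℝ} (h : S.PosDef) : klDist S S = 0 := by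
  unfold klDist
  rw [div_self h.det_pos.ne', nonsing_inv_mul _ h.det_pos.ne'.isUnit]
  simp
  ring

theorem posDef_convex {ι : Type*} {X Y : Matrix ι ι ℝ} (hX : X.PosDef) (hY : Y.PosDef) {l : ℝ}
    (hl : l ∈ Set.Icc (0 : ℝ) 1) : (l • X + (1 - l) • Y).PosDef := by
  rcases hl.1.eq_or_lt with h | h
  · simpa [← h] using hY
  · exact (hX.smul h).add_posSemidef (hY.posSemidef.smul (sub_nonneg.mpr hl.2))

/-- The Chernoff exponent at `l`, which is `-log ∫ f₁ ^ l * f₂ ^ (1 - l)` for the densities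
`f₁` and `f₂` of the two centered Gaussian distributions. -/
noncomputable def chernoffExponent (S₁ S₂ : Matrix V V ℝ) (l : ℝ) : ℝ :=
  1 / 2 * (Real.log (l • S₁⁻¹ + (1 - l) • S₂⁻¹).det + l * Real.log S₁.det +
    (1 - l) * Real.log S₂.det)

theorem chernoffExponent_swap (S₁ S₂ : Matrix V V ℝ) (l : ℝ) :
    chernoffExponent S₂ S₁ (1 - l) = chernoffExponent S₁ S₂ l := by
  unfold chernoffExponent
  rw [sub_sub_cancel, add_comm (l • S₁⁻¹)]
  ring

theorem posDef_mix {S₁ S₂ : Matrix V V ℝ} (h₁ : S₁.PosDef) (h₂ : S₂.PosDef) {l : ℝ}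
    (hl : l ∈ Set.Icc (0 : ℝ) 1) : (mix S₁ S₂ l).PosDef :=
  (posDef_convex h₁.inv h₂.inv hl).inv

/-- Log-determinants and traces enter linearly. The right side isolates the dependence on S in one
divergence, which vanishes when S is the mixture. -/
theorem klDist_combination {S S₁ S₂ : Matrix V V ℝ} (h : S.PosDef) (h₁ : S₁.PosDef)
    (h₂ : S₂.PosDef) {l : ℝ} (hl : l ∈ Set.Icc (0 : ℝ) 1) :
    l * klDist S S₁ + (1 - l) * klDist S S₂ =
      klDist S (mix S₁ S₂ l) + chernoffExponent S₁ S₂ l := by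
  have hM := posDef_convex h₁.inv h₂.inv hl
  unfold klDist chernoffExponent mix
  rw [nonsing_inv_nonsing_inv _ hM.det_pos.ne'.isUnit, det_nonsing_inv, Ring.inverse_eq_inv',
    Real.log_div h₁.det_pos.ne' h.det_pos.ne', Real.log_div h₂.det_pos.ne' h.det_pos.ne',
    Real.log_div (inv_pos.mpr hM.det_pos).ne' h.det_pos.ne', Real.log_inv]
  simp only [Matrix.add_mul, Matrix.smul_mul, Matrix.trace_add, Matrix.trace_smul, smul_eq_mul]
  ring

/-- Written by the adjugate, the inverse is polynomial in l apart from a nonvanishing determinant.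
-/
theorem continuousOn_mix {S₁ S₂ : Matrix V V ℝ} (h₁ : S₁.PosDef) (h₂ : S₂.PosDef) :
    ContinuousOn (mix S₁ S₂) (Set.Icc (0 : ℝ) 1) := by
  have hc : Continuous fun l : ℝ => l • S₁⁻¹ + (1 - l) • S₂⁻¹ := by fun_prop
  have heq : mix S₁ S₂ = fun l => (l • S₁⁻¹ + (1 - l) • S₂⁻¹).det⁻¹ •
      (l • S₁⁻¹ + (1 - l) • S₂⁻¹).adjugate := by
    funext l
    rw [mix, inv_def, Ring.inverse_eq_inv']
  rw [heq]
  exact (hc.matrix_det.continuousOn.inv₀ fun l hl =>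
    (posDef_convex h₁.inv h₂.inv hl).det_pos.ne').smul hc.matrix_adjugate.continuousOn

/-- The difference of the two divergences is continuous in l. It is D(S₂ ‖ S₁) ≥ 0 at l = 0 and
-D(S₁ ‖ S₂) ≤ 0 at l = 1. -/
theorem exists_isOptimal {S₁ S₂ : Matrix V V ℝ} (h₁ : S₁.PosDef) (h₂ : S₂.PosDef) :
    ∃ l, IsOptimal S₁ S₂ l := by
  have hd : ∀ l ∈ Set.Icc (0 : ℝ) 1,
      klDist (mix S₁ S₂ l) S₁ - klDist (mix S₁ S₂ l) S₂ =
        1 / 2 * (Real.log S₁.det - Real.log S₂.det) +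
          1 / 2 * ((S₁⁻¹ - S₂⁻¹) * mix S₁ S₂ l).trace := by
    intro l hl
    have hM := posDef_mix h₁ h₂ hl
    unfold klDist
    rw [Real.log_div h₁.det_pos.ne' hM.det_pos.ne', Real.log_div h₂.det_pos.ne' hM.det_pos.ne',
      Matrix.sub_mul, Matrix.trace_sub]
    ring
  have hcont : ContinuousOn (fun l => klDist (mix S₁ S₂ l) S₁ - klDist (mix S₁ S₂ l) S₂)
      (Set.Icc (0 : ℝ) 1) := by
    refine ContinuousOn.congr ?_ hd
    have hm := continuousOn_mix h₁ h₂
    have ht : Continuous fun M : Matrix V V ℝ => ((S₁⁻¹ - S₂⁻¹) * M).trace :=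
      (continuous_const.matrix_mul continuous_id).matrix_trace
    exact continuousOn_const.add (continuousOn_const.mul (ht.comp_continuousOn hm))
  have h0 : mix S₁ S₂ 0 = S₂ := by
    simp [mix, nonsing_inv_nonsing_inv _ h₂.det_pos.ne'.isUnit]
  have h1 : mix S₁ S₂ 1 = S₁ := by
    simp [mix, nonsing_inv_nonsing_inv _ h₁.det_pos.ne'.isUnit]
  have hmem : (0 : ℝ) ∈ Set.Icc (klDist (mix S₁ S₂ 1) S₁ - klDist (mix S₁ S₂ 1) S₂)
      (klDist (mix S₁ S₂ 0) S₁ - klDist (mix S₁ S₂ 0) S₂) := by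
    rw [h0, h1, klDist_self h₁, klDist_self h₂]
    constructor <;> linarith [klDist_nonneg h₁ h₂, klDist_nonneg h₂ h₁]
  obtain ⟨l, hl, hl0⟩ := intermediate_value_Icc' zero_le_one hcont hmem
  exact ⟨l, hl, sub_eq_zero.mp hl0⟩

/-- In `klDist_combination` at the optimal mixture, both divergences agree, so the left side is the
Chernoff information for every l. The divergence on the right is nonnegative, and zero at the
optimum. This makes the value independent of the chosen optimal parameter. -/
theorem chernoffInfo_isGreatest {S₁ S₂ : Matrix V V ℝ} (h₁ : S₁.PosDef) (h₂ : S₂.PosDef) :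
    IsGreatest (Set.image (chernoffExponent S₁ S₂) (Set.Icc 0 1)) (chernoffInfo S₁ S₂) := by
  have hopt : IsOptimal S₁ S₂ (Classical.epsilon (IsOptimal S₁ S₂)) :=
    Classical.epsilon_spec (exists_isOptimal h₁ h₂)
  unfold chernoffInfo
  set l₀ := Classical.epsilon (IsOptimal S₁ S₂)
  have hM := posDef_mix h₁ h₂ hopt.1
  constructor
  · refine ⟨l₀, hopt.1, ?_⟩
    have := klDist_combination hM h₁ h₂ hopt.1
    rw [klDist_self hM, hopt.2] at this
    linarith
  · rintro _ ⟨l, hl, rfl⟩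
    have := klDist_combination hM h₁ h₂ hl
    rw [hopt.2] at this
    linarith [klDist_nonneg hM (posDef_mix h₁ h₂ hl)]

theorem chernoffInfo_comm {S₁ S₂ : Matrix V V ℝ} (h₁ : S₁.PosDef) (h₂ : S₂.PosDef) :
    chernoffInfo S₁ S₂ = chernoffInfo S₂ S₁ := by
  have himage : Set.image (chernoffExponent S₁ S₂) (Set.Icc 0 1) =
      Set.image (chernoffExponent S₂ S₁) (Set.Icc 0 1) := by
    ext y
    constructor <;> rintro ⟨l, hl, rfl⟩ <;>
      exact ⟨1 - l, ⟨by linarith [hl.2], by linarith [hl.1]⟩, chernoffExponent_swap _ _ _⟩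
  exact (himage ▸ chernoffInfo_isGreatest h₁ h₂).unique (chernoffInfo_isGreatest h₂ h₁)

theorem chernoffInfo_mono {S₁ S₂ S₁' S₂' : Matrix V V ℝ} (h₁ : S₁.PosDef) (h₂ : S₂.PosDef)
    (h₁' : S₁'.PosDef) (h₂' : S₂'.PosDef) (hd₁ : S₁.det = S₁'.det) (hd₂ : S₂.det = S₂'.det)
    (hle : ∀ l ∈ Set.Icc (0 : ℝ) 1,
      (l • S₁⁻¹ + (1 - l) • S₂⁻¹).det ≤ (l • S₁'⁻¹ + (1 - l) • S₂'⁻¹).det) :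
    chernoffInfo S₁ S₂ ≤ chernoffInfo S₁' S₂' := by
  obtain ⟨l, hl, heq⟩ := (chernoffInfo_isGreatest h₁ h₂).1
  rw [← heq]
  refine le_trans ?_ ((chernoffInfo_isGreatest h₁' h₂').2 ⟨l, hl, rfl⟩)
  have := Real.log_le_log (posDef_convex h₁.inv h₂.inv hl).det_pos (hle l hl)
  unfold chernoffExponent
  rw [hd₁, hd₂]
  linarith

/-- The logarithm of the determinant is concave, so the determinant does not drop on a segment
between two matrices of the same determinant. -/
theorem det_le_det_convex {X Y : Matrix V V ℝ} (hX : X.PosDef) (hY : Y.PosDef)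
    (hdet : X.det = Y.det) {l : ℝ} (hl : l ∈ Set.Icc (0 : ℝ) 1) :
    X.det ≤ (l • X + (1 - l) • Y).det := by
  have hM := posDef_convex hX hY hl
  -- With S the mixture itself, the exponent becomes an average of divergences, hence nonnegative.
  have h := klDist_combination hM.inv hX.inv hY.inv hl
  have hXX := nonsing_inv_nonsing_inv _ hX.det_pos.ne'.isUnit
  have hYY := nonsing_inv_nonsing_inv _ hY.det_pos.ne'.isUnit
  rw [mix, hXX, hYY, klDist_self hM.inv, chernoffExponent, hXX, hYY] at h
  simp only [det_nonsing_inv, Ring.inverse_eq_inv', Real.log_inv, ← hdet] at h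
  have hn := add_nonneg (mul_nonneg hl.1 (klDist_nonneg hM.inv hX.inv))
    (mul_nonneg (sub_nonneg.mpr hl.2) (klDist_nonneg hM.inv hY.inv))
  exact (Real.log_le_log_iff hX.det_pos hM.det_pos).mp (by linarith)

end Gaussian

/-! ### The inverse covariance matrix of a tree. -/

namespace GaussianTree

open Matrix

/-- The weight that an edge of correlation `w` contributes to the diagonal of the inverse
covariance matrix. -/
noncomputable def diagWeight (w : ℝ) : ℝ := w ^ 2 / (1 - w ^ 2)

/-- The negative of the entry of an edge of correlation `w` in the inverse covariance matrix. -/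
noncomputable def offWeight (w : ℝ) : ℝ := w / (1 - w ^ 2)

@[simp] theorem diagWeight_zero : diagWeight 0 = 0 := by simp [diagWeight]

@[simp] theorem offWeight_zero : offWeight 0 = 0 := by simp [offWeight]

theorem one_sub_sq_pos {w : ℝ} (hw : |w| < 1) : 0 < 1 - w ^ 2 :=
  sub_pos.mpr ((sq_lt_one_iff_abs_lt_one w).mpr hw)

theorem diagWeight_nonneg {w : ℝ} (hw : |w| < 1) : 0 ≤ diagWeight w :=
  div_nonneg (sq_nonneg w) (one_sub_sq_pos hw).le

theorem offWeight_mul_self (w : ℝ) : offWeight w * w = diagWeight w := by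
  unfold offWeight diagWeight
  ring

theorem diagWeight_mul_self {w : ℝ} (hw : |w| < 1) : diagWeight w * w = offWeight w - w := by
  have := (one_sub_sq_pos hw).ne'
  unfold offWeight diagWeight
  field_simp
  ring

theorem offWeight_sq {w : ℝ} (hw : |w| < 1) :
    offWeight w ^ 2 = diagWeight w ^ 2 + diagWeight w := by
  have := (one_sub_sq_pos hw).ne'
  unfold offWeight diagWeight
  field_simp
  ring

/-- Complete the square. In a rooted tree, the identity term of a child thus pays for the edge to
its parent. -/
theorem neg_sq_le_edge_form {w : ℝ} (hw : |w| < 1) (x y : ℝ) :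
    -x ^ 2 ≤ diagWeight w * (x ^ 2 + y ^ 2) - 2 * offWeight w * (x * y) := by
  have h := one_sub_sq_pos hw
  have key : diagWeight w * (x ^ 2 + y ^ 2) - 2 * offWeight w * (x * y) + x ^ 2 =
      (x - w * y) ^ 2 / (1 - w ^ 2) := by
    unfold offWeight diagWeight
    field_simp
    ring
  linarith [div_nonneg (sq_nonneg (x - w * y)) h.le]

variable {V : Type*}

theorem path_isPath (T : GaussianTree V) (u v : V) : (T.path u v).IsPath :=
  (T.isTree.existsUnique_path u v).choose_spec.1

theorem eq_path (T : GaussianTree V) {u v : V} {p : T.graph.Walk u v} (hp : p.IsPath) :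
    p = T.path u v :=
  (T.isTree.existsUnique_path u v).choose_spec.2 p hp

@[simp] theorem cov_self (T : GaussianTree V) (u : V) : T.cov u u = 1 := by
  rw [cov, of_apply, ← T.eq_path SimpleGraph.Walk.IsPath.nil]
  simp

theorem cov_of_adj (T : GaussianTree V) {u v : V} (h : T.graph.Adj u v) :
    T.cov u v = T.weight s(u, v) := by
  rw [cov, of_apply, ← T.eq_path (SimpleGraph.Path.singleton h).2]
  simp [SimpleGraph.Path.singleton]

/-- The last vertex before `v` on the path from `r` to `v`. -/
noncomputable def parent (T : GaussianTree V) (r v : V) : V := (T.path r v).penultimate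

theorem path_eq_concat (T : GaussianTree V) {r x v : V} (h : T.graph.Adj x v)
    (hx : x ∈ (T.path r v).support) : T.path r v = (T.path r x).concat h :=
  T.isTree.isAcyclic.path_concat (T.path_isPath r x) (T.path_isPath r v) h hx

theorem parent_eq_and_cov_eq (T : GaussianTree V) {r x v : V} (h : T.graph.Adj x v)
    (hx : x ∈ (T.path r v).support) :
    T.parent r v = x ∧ T.cov r v = T.cov r x * T.weight s(x, v) := by
  constructor
  · rw [parent, T.path_eq_concat h hx, SimpleGraph.Walk.penultimate_concat]
  · rw [cov, of_apply, of_apply, T.path_eq_concat h hx, SimpleGraph.Walk.edges_concat]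
    simp

theorem parent_or_parent (T : GaussianTree V) (r : V) {x v : V} (h : T.graph.Adj x v) :
    (T.parent r v = x ∧ T.cov r v = T.cov r x * T.weight s(x, v)) ∨
      (T.parent r x = v ∧ T.cov r x = T.cov r v * T.weight s(v, x)) := by
  by_cases hx : x ∈ (T.path r v).support
  · exact .inl (T.parent_eq_and_cov_eq h hx)
  · exact .inr (T.parent_eq_and_cov_eq h.symm
      (T.isTree.isAcyclic.mem_support_of_ne_mem_support_of_adj_of_isPath
        (T.path_isPath r x) (T.path_isPath r v) h hx))

theorem parent_adj_and_cov_eq (T : GaussianTree V) {r v : V} (h : r ≠ v) :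
    T.graph.Adj (T.parent r v) v ∧
      T.cov r v = T.cov r (T.parent r v) * T.weight s(T.parent r v, v) := by
  have hadj : T.graph.Adj (T.parent r v) v :=
    (T.path r v).adj_penultimate (SimpleGraph.Walk.not_nil_of_ne h)
  exact ⟨hadj, (T.parent_eq_and_cov_eq hadj ((T.path r v).getVert_mem_support _)).2⟩

/-- The weight of an edge of the tree, extended by zero to all pairs of vertices. -/
noncomputable def edgeWeight (T : GaussianTree V) : Sym2 V → ℝ :=
  T.graph.edgeSet.indicator T.weight

theorem edgeWeight_of_mem (T : GaussianTree V) {e : Sym2 V} (h : e ∈ T.graph.edgeSet) :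
    T.edgeWeight e = T.weight e :=
  Set.indicator_of_mem h _

theorem edgeWeight_of_notMem (T : GaussianTree V) {e : Sym2 V} (h : e ∉ T.graph.edgeSet) :
    T.edgeWeight e = 0 :=
  Set.indicator_of_notMem h _

theorem edgeWeight_of_adj (T : GaussianTree V) {u v : V} (h : T.graph.Adj u v) :
    T.edgeWeight s(u, v) = T.weight s(u, v) :=
  T.edgeWeight_of_mem h

theorem edgeWeight_of_not_adj (T : GaussianTree V) {u v : V} (h : ¬ T.graph.Adj u v) :
    T.edgeWeight s(u, v) = 0 :=
  T.edgeWeight_of_notMem h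

theorem abs_edgeWeight_lt_one (T : GaussianTree V) (e : Sym2 V) : |T.edgeWeight e| < 1 := by
  by_cases h : e ∈ T.graph.edgeSet
  · rw [T.edgeWeight_of_mem h]
    exact T.abs_weight_lt_one e h
  · rw [T.edgeWeight_of_notMem h]
    simp

variable [Fintype V] [DecidableEq V]

/-- The inverse covariance matrix belonging to a weight function on the pairs of vertices. -/
noncomputable def info (ω : Sym2 V → ℝ) : Matrix V V ℝ :=
  diagonal (fun v => 1 + ∑ x, diagWeight (ω s(v, x))) - of fun u v => offWeight (ω s(u, v))

theorem info_mulVec (ω : Sym2 V → ℝ) (x : V → ℝ) (v : V) :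
    (info ω *ᵥ x) v =
      x v + ∑ y, (diagWeight (ω s(v, y)) * x v - offWeight (ω s(v, y)) * x y) := by
  rw [info, sub_mulVec, Pi.sub_apply, mulVec_diagonal, Finset.sum_sub_distrib, ← Finset.sum_mul]
  simp only [mulVec, dotProduct, of_apply]
  ring

theorem info_isSymm (ω : Sym2 V → ℝ) : (info ω).IsSymm := by
  unfold info
  refine IsSymm.sub (isSymm_diagonal _) ?_
  ext u v
  simp [Sym2.eq_swap]

theorem info_isHermitian (ω : Sym2 V → ℝ) : (info ω).IsHermitian := by
  rw [IsHermitian, conjTranspose_eq_transpose_of_trivial]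
  exact info_isSymm ω

/-- Root the tree at r. In row v every child's term cancels, and the parent's term cancels the
identity term; only the root, having no parent edge, keeps its 1. The transpose appears because
paths are read from r and the symmetry of `cov` is not yet known. -/
theorem info_mul_cov (T : GaussianTree V) : info T.edgeWeight * T.covᵀ = 1 := by
  ext v r
  change (info T.edgeWeight *ᵥ fun x => T.cov r x) v = _
  rw [info_mulVec]
  have hzero : ∀ y, T.cov r y = T.cov r v * T.weight s(v, y) → T.graph.Adj v y →
      diagWeight (T.edgeWeight s(v, y)) * T.cov r v -
        offWeight (T.edgeWeight s(v, y)) * T.cov r y = 0 := by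
    intro y hy hadj
    rw [hy, T.edgeWeight_of_adj hadj, ← offWeight_mul_self]
    ring
  by_cases hvr : v = r
  · subst hvr
    rw [Finset.sum_eq_zero, one_apply_eq]
    · simp
    · intro y _
      by_cases hadj : T.graph.Adj v y
      · exact hzero y (by rw [T.cov_of_adj hadj, cov_self, one_mul]) hadj
      · simp [T.edgeWeight_of_not_adj hadj]
  · obtain ⟨hadj, hcov⟩ := T.parent_adj_and_cov_eq (Ne.symm hvr)
    rw [one_apply_ne hvr, Finset.sum_eq_single (T.parent r v)]
    · rw [T.edgeWeight_of_adj hadj.symm, Sym2.eq_swap]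
      have h := diagWeight_mul_self (T.abs_weight_lt_one s(T.parent r v, v) hadj)
      linear_combination (1 + diagWeight (T.weight s(T.parent r v, v))) * hcov +
        T.cov r (T.parent r v) * h
    · intro y _ hy
      by_cases hvy : T.graph.Adj v y
      · rcases T.parent_or_parent r hvy.symm with h | h
        · exact absurd h.1.symm hy
        · exact hzero y h.2 hvy
      · simp [T.edgeWeight_of_not_adj hvy]
    · simp

/-- Doubling allows a symmetric sum over ordered pairs. -/
theorem info_quadratic_form (ω : Sym2 V → ℝ) (x : V → ℝ) :
    2 * (x ⬝ᵥ info ω *ᵥ x) = 2 * ∑ v, x v ^ 2 + ∑ u, ∑ v,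
      (diagWeight (ω s(u, v)) * (x u ^ 2 + x v ^ 2) - 2 * offWeight (ω s(u, v)) * (x u * x v)) := by
  have h : x ⬝ᵥ info ω *ᵥ x = ∑ v, x v ^ 2 + ∑ u, ∑ v,
      (diagWeight (ω s(u, v)) * x u ^ 2 - offWeight (ω s(u, v)) * (x u * x v)) := by
    simp only [dotProduct, info_mulVec, mul_add, Finset.sum_add_distrib, Finset.mul_sum]
    congr 1
    · exact Finset.sum_congr rfl fun v _ => by ring
    · exact Finset.sum_congr rfl fun u _ => Finset.sum_congr rfl fun v _ => by ring
  have h' : ∑ u, ∑ v, (diagWeight (ω s(u, v)) * x u ^ 2 - offWeight (ω s(u, v)) * (x u * x v)) =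
      ∑ u, ∑ v, (diagWeight (ω s(u, v)) * x v ^ 2 - offWeight (ω s(u, v)) * (x u * x v)) := by
    rw [Finset.sum_comm]
    exact Finset.sum_congr rfl fun u _ => Finset.sum_congr rfl fun v _ => by
      rw [Sym2.eq_swap, mul_comm (x u)]
  rw [two_mul, h]
  nth_rewrite 2 [h']
  rw [add_add_add_comm, ← two_mul, ← Finset.sum_add_distrib]
  congr 1
  exact Finset.sum_congr rfl fun u _ => by
    rw [← Finset.sum_add_distrib]
    exact Finset.sum_congr rfl fun v _ => by ring

theorem info_posSemidef (T : GaussianTree V) : (info T.edgeWeight).PosSemidef := by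
  refine .of_dotProduct_mulVec_nonneg (info_isHermitian _) fun x => ?_
  rw [star_trivial]
  obtain ⟨r⟩ := T.isTree.connected.nonempty
  -- Each edge is charged to its child. The root is its own `parent`, which only weakens the bound,
  -- and so every vertex is charged exactly once in each order.
  have hbound : ∀ u v, -(if T.parent r u = v then x u ^ 2 else 0) -
      (if T.parent r v = u then x v ^ 2 else 0) ≤
      diagWeight (T.edgeWeight s(u, v)) * (x u ^ 2 + x v ^ 2) -
        2 * offWeight (T.edgeWeight s(u, v)) * (x u * x v) := by
    intro u v
    have hnn : ∀ (p : Prop) [Decidable p] (y : ℝ), 0 ≤ if p then y ^ 2 else 0 :=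
      fun p _ y => by split_ifs <;> positivity
    by_cases hadj : T.graph.Adj u v
    · have hw := T.abs_edgeWeight_lt_one s(u, v)
      rcases T.parent_or_parent r hadj with h | h
      · rw [if_pos h.1]
        have := neg_sq_le_edge_form hw (x v) (x u)
        linarith [hnn (T.parent r u = v) (x u)]
      · rw [if_pos h.1]
        have := neg_sq_le_edge_form hw (x u) (x v)
        linarith [hnn (T.parent r v = u) (x v)]
    · rw [T.edgeWeight_of_not_adj hadj, diagWeight_zero, offWeight_zero]
      linarith [hnn (T.parent r u = v) (x u), hnn (T.parent r v = u) (x v)]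
  have hsum := Finset.sum_le_sum fun u (_ : u ∈ Finset.univ) =>
    Finset.sum_le_sum fun v (_ : v ∈ Finset.univ) => hbound u v
  have hleft : ∑ u, ∑ v, (-(if T.parent r u = v then x u ^ 2 else 0) -
      (if T.parent r v = u then x v ^ 2 else 0)) = -(2 * ∑ v, x v ^ 2) := by
    simp only [Finset.sum_sub_distrib, Finset.sum_neg_distrib]
    rw [Finset.sum_comm (f := fun u v => if T.parent r v = u then x v ^ 2 else 0)]
    simp only [Finset.sum_ite_eq, Finset.mem_univ, if_true]
    ring
  have hq := info_quadratic_form T.edgeWeight x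
  linarith

theorem info_posDef (T : GaussianTree V) : (info T.edgeWeight).PosDef :=
  T.info_posSemidef.posDef_iff_isUnit.mpr
    ((isUnit_iff_isUnit_det _).mpr (isUnit_det_of_right_inverse T.info_mul_cov))

theorem cov_eq_inv_info (T : GaussianTree V) : T.cov = (info T.edgeWeight)⁻¹ := by
  rw [← T.cov.transpose_transpose, ← inv_eq_right_inv T.info_mul_cov, transpose_nonsing_inv,
    (info_isSymm T.edgeWeight).eq]

theorem info_mul_cov' (T : GaussianTree V) : info T.edgeWeight * T.cov = 1 := by
  rw [cov_eq_inv_info, mul_nonsing_inv _ T.info_posDef.det_pos.ne'.isUnit]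

theorem cov_posDef (T : GaussianTree V) : T.cov.PosDef :=
  T.cov_eq_inv_info ▸ T.info_posDef.inv

theorem inv_cov (T : GaussianTree V) : T.cov⁻¹ = info T.edgeWeight := by
  rw [cov_eq_inv_info, nonsing_inv_nonsing_inv _ T.info_posDef.det_pos.ne'.isUnit]

end GaussianTree

/-! ### Adding, erasing and moving one edge. -/

namespace GaussianTree

open Matrix

variable {V : Type*} [DecidableEq V]

/-- The contribution of an edge `uv` of correlation `w` to the inverse covariance matrix. -/
noncomputable def edgeMatrix (u v : V) (w : ℝ) : Matrix V V ℝ :=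
  of fun a b => (if a = u ∧ b = u then diagWeight w else 0) +
    (if a = v ∧ b = v then diagWeight w else 0) -
    ((if a = u ∧ b = v then offWeight w else 0) + (if a = v ∧ b = u then offWeight w else 0))

theorem apply_update_edge {f : ℝ → ℝ} (hf : f 0 = 0) {ω : Sym2 V → ℝ} {u v : V} (huv : u ≠ v)
    (hω : ω s(u, v) = 0) (w : ℝ) (a b : V) :
    f (Function.update ω s(u, v) w s(a, b)) = f (ω s(a, b)) +
      ((if a = u ∧ b = v then f w else 0) + (if a = v ∧ b = u then f w else 0)) := by
  by_cases h : s(a, b) = s(u, v)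
  · rw [h, Function.update_self, hω, hf]
    rcases Sym2.eq_iff.mp h with ⟨rfl, rfl⟩ | ⟨rfl, rfl⟩
    · simp [huv]
    · simp [huv.symm]
  · rw [Function.update_of_ne h]
    rw [Sym2.eq_iff, not_or] at h
    simp [h.1, h.2]

/-- The rank-two factorization required by the matrix determinant lemma. -/
theorem edgeMatrix_eq_mul (u v : V) (w : ℝ) :
    edgeMatrix u v w = (of fun a (j : Fin 2) => if a = ![u, v] j then (1 : ℝ) else 0) *
      (!![diagWeight w, -offWeight w; -offWeight w, diagWeight w] *
        (of fun (j : Fin 2) a => if a = ![u, v] j then (1 : ℝ) else 0)) := by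
  ext a b
  have hu : ∀ c, (if c = ![u, v] 0 then (1 : ℝ) else 0) = if c = u then 1 else 0 := fun _ => rfl
  have hv : ∀ c, (if c = ![u, v] 1 then (1 : ℝ) else 0) = if c = v then 1 else 0 := fun _ => rfl
  have hand : ∀ (c d : V) (t : ℝ), (if a = c ∧ b = d then t else 0) =
      (if a = c then 1 else 0) * t * (if b = d then 1 else 0) := by
    intro c d t
    rw [ite_and]
    split_ifs <;> simp
  simp only [edgeMatrix, mul_apply, of_apply, Fin.sum_univ_two]
  simp only [hu, hv, hand]
  simp only [cons_val_zero, cons_val_one, cons_val', cons_val_fin_one]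
  ring

theorem edgeMatrix_isHermitian (u v : V) (w : ℝ) : (edgeMatrix u v w).IsHermitian := by
  ext a b
  simp only [edgeMatrix, conjTranspose_apply, of_apply, star_trivial, and_comm]
  ring

/-- The tree in which the weight of the edge `e` is replaced by zero. -/
def eraseWeight (T : GaussianTree V) (e : Sym2 V) : GaussianTree V where
  graph := T.graph
  isTree := T.isTree
  weight := Function.update T.weight e 0
  abs_weight_lt_one e' he' := by
    by_cases h : e' = e
    · simp [h]
    · rw [Function.update_of_ne h]
      exact T.abs_weight_lt_one e' he'

theorem edgeWeight_eraseWeight (T : GaussianTree V) (e : Sym2 V) :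
    (T.eraseWeight e).edgeWeight = Function.update T.edgeWeight e 0 := by
  ext e'
  by_cases he : e' ∈ T.graph.edgeSet
  · rw [(T.eraseWeight e).edgeWeight_of_mem he]
    by_cases h : e' = e
    · simp [eraseWeight, h]
    · simp [eraseWeight, h, T.edgeWeight_of_mem he]
  · rw [(T.eraseWeight e).edgeWeight_of_notMem he]
    by_cases h : e' = e
    · simp [h]
    · simp [h, T.edgeWeight_of_notMem he]

variable [Fintype V]

theorem info_update {ω : Sym2 V → ℝ} {u v : V} (huv : u ≠ v) (hω : ω s(u, v) = 0) (w : ℝ) :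
    info (Function.update ω s(u, v) w) = info ω + edgeMatrix u v w := by
  ext a b
  have hdiag : ∑ x, diagWeight (Function.update ω s(u, v) w s(a, x)) =
      ∑ x, diagWeight (ω s(a, x)) +
        ((if a = u then diagWeight w else 0) + (if a = v then diagWeight w else 0)) := by
    simp only [apply_update_edge diagWeight_zero huv hω, Finset.sum_add_distrib, ite_and]
    congr 2 <;> split_ifs <;> simp
  simp only [info, edgeMatrix, Matrix.sub_apply, Matrix.add_apply, of_apply, diagonal_apply, hdiag,
    apply_update_edge offWeight_zero huv hω]
  by_cases hab : a = b
  · subst hab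
    simp only [if_true, and_self]
    ring
  · have h : ∀ c, ¬ (a = c ∧ b = c) := fun c hc => hab (hc.1.trans hc.2.symm)
    simp only [hab, h, if_false]
    ring

/-- Here z is column r of G⁻¹, so the (r, r) entry is 1 and the (r, s) entry is 0. With g the (s, s)
entry and d, o the edge weights, the 2 × 2 determinant is (1 + d)(1 + d g) - o² g, and o² = d² + d
removes g. -/
theorem det_add_edgeMatrix {G : Matrix V V ℝ} (hG : G.PosDef) {r s : V} {z : V → ℝ}
    (hz : G *ᵥ z = Pi.single r 1) (hr : z r = 1) (hs : z s = 0) {w : ℝ} (hw : |w| < 1) :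
    (G + edgeMatrix r s w).det = G.det * (1 + diagWeight w) := by
  have hunit := hG.det_pos.ne'.isUnit
  have hcol : ∀ a, G⁻¹ a r = z a := by
    intro a
    have : G⁻¹ *ᵥ (G *ᵥ z) = z := by rw [mulVec_mulVec, nonsing_inv_mul _ hunit, one_mulVec]
    rw [hz, mulVec_single_one] at this
    exact congrFun this a
  have hrow : G⁻¹ r s = 0 := by
    rw [← hs, ← hcol s]
    simpa using (hG.inv.isHermitian.apply r s).symm
  rw [edgeMatrix_eq_mul, det_add_mul _ _ hunit]
  congr 1
  have hsub : (of fun (j : Fin 2) a => if a = ![r, s] j then (1 : ℝ) else 0) * G⁻¹ *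
      (of fun a (j : Fin 2) => if a = ![r, s] j then (1 : ℝ) else 0) =
      !![1, 0; 0, G⁻¹ s s] := by
    ext j j'
    have : ((of fun (j : Fin 2) a => if a = ![r, s] j then (1 : ℝ) else 0) * G⁻¹ *
      (of fun a (j : Fin 2) => if a = ![r, s] j then (1 : ℝ) else 0)) j j' =
        G⁻¹ (![r, s] j) (![r, s] j') := by
      simp [mul_apply]
    rw [this]
    fin_cases j <;> fin_cases j' <;> simp [hcol, hr, hs, hrow]
  rw [Matrix.mul_assoc, Matrix.mul_assoc, ← Matrix.mul_assoc _ G⁻¹, hsub, det_fin_two]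
  have h := offWeight_sq hw
  simp
  linear_combination (-G⁻¹ s s) * h

theorem edgeMatrix_quadratic_form (u v : V) (w : ℝ) (x : V → ℝ) :
    x ⬝ᵥ edgeMatrix u v w *ᵥ x =
      diagWeight w * (x u ^ 2 + x v ^ 2) - 2 * offWeight w * (x u * x v) := by
  have h : ∀ (c d : V) (t : ℝ),
      ∑ a, x a * ∑ b, (if a = c ∧ b = d then t else 0) * x b = t * (x c * x d) := by
    intro c d t
    simp only [ite_and, ite_mul, zero_mul]
    rw [Finset.sum_eq_single c (fun a _ ha => by simp [ha]) (by simp)]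
    simp
    ring
  simp only [dotProduct, mulVec, edgeMatrix, of_apply, add_mul, sub_mul, Finset.sum_add_distrib,
    Finset.sum_sub_distrib, mul_add, mul_sub, h]
  ring

theorem posDef_add_edgeMatrix {G : Matrix V V ℝ} (hG : G.PosDef) {r s : V} {z : V → ℝ}
    (hz : G *ᵥ z = Pi.single r 1) (hr : z r = 1) (hs : z s = 0) {w : ℝ} (hw : |w| < 1) :
    (G + edgeMatrix r s w).PosDef := by
  have hpsd : (G + edgeMatrix r s w).PosSemidef := by
    refine .of_dotProduct_mulVec_nonneg (hG.isHermitian.add (edgeMatrix_isHermitian r s w))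
      fun x => ?_
    rw [star_trivial, add_mulVec, dotProduct_add, edgeMatrix_quadratic_form]
    have hsymm : z ⬝ᵥ G *ᵥ x = x r := by
      have hGt : Gᵀ = G := by
        rw [← conjTranspose_eq_transpose_of_trivial]
        exact hG.isHermitian
      rw [dotProduct_mulVec, ← mulVec_transpose, hGt, hz, single_one_dotProduct]
    -- Subtracting x r • z from x shows that the form of G is at least (x r)², which pays for the
    -- new edge.
    have h := hG.posSemidef.dotProduct_mulVec_nonneg (x - x r • z)
    rw [star_trivial, mulVec_sub, mulVec_smul, sub_dotProduct, dotProduct_sub, dotProduct_sub,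
      smul_dotProduct, smul_dotProduct, dotProduct_smul, dotProduct_smul, hsymm, hz,
      dotProduct_single_one, dotProduct_single_one, hr] at h
    simp only [smul_eq_mul] at h
    have := neg_sq_le_edge_form hw (x r) (x s)
    nlinarith
  rw [hpsd.posDef_iff_det_ne_zero, det_add_edgeMatrix hG hz hr hs hw]
  exact (mul_pos hG.det_pos (by linarith [diagWeight_nonneg hw])).ne'

/-- Zero is an admissible weight, so a cut tree is still a Gaussian tree and forests need no
separate treatment. -/
theorem posDef_info_update_zero (T : GaussianTree V) (e : Sym2 V) :
    (info (Function.update T.edgeWeight e 0)).PosDef :=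
  T.edgeWeight_eraseWeight e ▸ (T.eraseWeight e).info_posDef

/-- If `rs` is the only edge that leaves the set `L`, then after the removal of `rs` the column of
`r` in the covariance matrix is the old one, restricted to `L`. -/
theorem exists_column_of_cut (T : GaussianTree V) {L : Set V} {r s : V} (hr : r ∈ L) (hs : s ∉ L)
    (hadj : T.graph.Adj r s)
    (hcut : ∀ u v, T.graph.Adj u v → u ∈ L → v ∉ L → u = r ∧ v = s) :
    ∃ z : V → ℝ, (∀ v ∉ L, z v = 0) ∧ z r = 1 ∧
      info (Function.update T.edgeWeight s(r, s) 0) *ᵥ z = Pi.single r 1 := by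
  classical
  set ρ := Function.update T.edgeWeight s(r, s) 0
  have hcross : ∀ u v, u ∈ L → v ∉ L → ρ s(u, v) = 0 := by
    intro u v hu hv
    by_cases h : s(u, v) = s(r, s)
    · simp [ρ, h]
    · simp only [ρ, Function.update_of_ne h]
      refine T.edgeWeight_of_not_adj fun hA => h ?_
      rw [(hcut u v hA hu hv).1, (hcut u v hA hu hv).2]
  refine ⟨fun x => if x ∈ L then T.cov x r else 0, fun v hv => if_neg hv, by simp [hr], ?_⟩
  ext v
  rw [info_mulVec]
  by_cases hv : v ∈ L
  -- Compare with row v before the cut. Only the edge rs differs, and its term there is already zero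
  -- because the covariance of r and s is its weight.
  · have hcol := congrFun (congrFun T.info_mul_cov' v) r
    change (info T.edgeWeight *ᵥ fun x => T.cov x r) v = _ at hcol
    rw [info_mulVec] at hcol
    rw [Pi.single_apply, ← one_apply, ← hcol, if_pos hv]
    congr 1
    refine Finset.sum_congr rfl fun y _ => ?_
    by_cases hy : y ∈ L
    · have hne : s(v, y) ≠ s(r, s) := by
        intro h
        rcases Sym2.eq_iff.mp h with ⟨-, rfl⟩ | ⟨rfl, -⟩
        exacts [hs hy, hs hv]
      simp only [if_pos hy, ρ, Function.update_of_ne hne]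
    · rw [hcross v y hv hy, if_neg hy]
      by_cases hA : T.graph.Adj v y
      · obtain ⟨rfl, rfl⟩ := hcut v y hA hv hy
        rw [T.edgeWeight_of_adj hA, T.cov_of_adj hA.symm, Sym2.eq_swap (a := y)]
        simp [offWeight_mul_self]
      · simp [T.edgeWeight_of_not_adj hA]
  · have hvr : v ≠ r := fun h => hv (h ▸ hr)
    rw [if_neg hv, Pi.single_eq_of_ne hvr, zero_add]
    refine Finset.sum_eq_zero fun y _ => ?_
    by_cases hy : y ∈ L
    · rw [Sym2.eq_swap, hcross y v hy hv]
      simp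
    · simp [hy]

theorem info_mulVec_congr {ρ ρ' : Sym2 V → ℝ} {L : Set V}
    (h : ∀ u ∈ L, ∀ v, ρ s(u, v) = ρ' s(u, v)) {z : V → ℝ} (hz : ∀ v ∉ L, z v = 0) :
    info ρ *ᵥ z = info ρ' *ᵥ z := by
  ext v
  rw [info_mulVec, info_mulVec]
  congr 1
  refine Finset.sum_congr rfl fun y _ => ?_
  by_cases hv : v ∈ L
  · rw [h v hv y]
  · rw [hz v hv]
    by_cases hy : y ∈ L
    · rw [Sym2.eq_swap, h y hy v]
    · rw [hz y hy]
      simp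

/-- Two trees share a subtree on `L`, joined to the rest by the edge `rs`. If in one of them this
edge is replaced by another edge `r's'` of the same kind, the determinant of the mixture of the
inverse covariance matrices does not decrease. -/
theorem det_mixture_le_of_move {ρ₀ ρ ρ' : Sym2 V → ℝ} {L : Set V} {r s r' s' : V}
    {z z' : V → ℝ} {w l : ℝ} (hρ : (info ρ).PosDef) (hρ' : (info ρ').PosDef)
    (hagree : ∀ u ∈ L, ∀ v, ρ s(u, v) = ρ₀ s(u, v))
    (hagree' : ∀ u ∈ L, ∀ v, ρ' s(u, v) = ρ₀ s(u, v))
    (hr : r ∈ L) (hs : s ∉ L) (hr' : r' ∈ L) (hs' : s' ∉ L)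
    (hzL : ∀ v ∉ L, z v = 0) (hzr : z r = 1) (hz : info ρ₀ *ᵥ z = Pi.single r 1)
    (hzL' : ∀ v ∉ L, z' v = 0) (hzr' : z' r' = 1) (hz' : info ρ₀ *ᵥ z' = Pi.single r' 1)
    (h₀ : ρ₀ s(r, s) = 0) (h₀' : ρ₀ s(r', s') = 0) (hw : |w| < 1) (hl : l ∈ Set.Icc (0 : ℝ) 1) :
    (l • info (Function.update ρ s(r, s) w) +
        (1 - l) • info (Function.update ρ' s(r, s) w)).det ≤
      (l • info (Function.update ρ s(r, s) w) +
        (1 - l) • info (Function.update ρ' s(r', s') w)).det := by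
  have hrs : r ≠ s := fun h => hs (h ▸ hr)
  have hrs' : r' ≠ s' := fun h => hs' (h ▸ hr')
  rw [info_update hrs ((hagree r hr s).trans h₀), info_update hrs ((hagree' r hr s).trans h₀),
    info_update hrs' ((hagree' r' hr' s').trans h₀')]
  have hG := Gaussian.posDef_convex hρ hρ' hl
  set G := l • info ρ + (1 - l) • info ρ'
  -- On vectors supported in L the mixture acts as `info ρ₀`, so z and z' are also columns of its
  -- inverse.
  have hGz : ∀ x : V → ℝ, (∀ v ∉ L, x v = 0) → G *ᵥ x = info ρ₀ *ᵥ x := by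
    intro x hx
    rw [add_mulVec, smul_mulVec, smul_mulVec, info_mulVec_congr hagree hx,
      info_mulVec_congr hagree' hx, ← add_smul]
    simp
  have hz₁ := (hGz z hzL).trans hz
  have hz₂ := (hGz z' hzL').trans hz'
  have hX := posDef_add_edgeMatrix hG hz₁ hzr (hzL s hs) hw
  have hY := posDef_add_edgeMatrix hG hz₂ hzr' (hzL' s' hs') hw
  have hdet : (G + edgeMatrix r s w).det = (G + edgeMatrix r' s' w).det := by
    rw [det_add_edgeMatrix hG hz₁ hzr (hzL s hs) hw, det_add_edgeMatrix hG hz₂ hzr' (hzL' s' hs') hw]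
  -- The unmoved mixture is X itself; the moved one is l X + (1 - l) Y.
  convert Gaussian.det_le_det_convex hX hY hdet hl using 2
  · simp only [G]
    module
  · simp only [G]
    module

end GaussianTree

/-! ### Graph and induction tools. -/

/-- Deleting uv leaves A and B connected, so a second edge between them would join u to v again,
although uv is a bridge. -/
theorem SimpleGraph.IsAcyclic.eq_of_adj_of_connected {V : Type*} {G : SimpleGraph V}
    (hG : G.IsAcyclic) {A B : Set V} (hdisj : Disjoint A B) (hA : (G.induce A).Connected)
    (hB : (G.induce B).Connected) {u v u' v' : V} (hu : u ∈ A) (hv : v ∈ B) (hu' : u' ∈ A)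
    (hv' : v' ∈ B) (h : G.Adj u v) (h' : G.Adj u' v') : s(u, v) = s(u', v') := by
  by_contra hne
  have hbridge := SimpleGraph.isAcyclic_iff_forall_isBridge.mp hG (e := s(u, v)) h
  rw [SimpleGraph.isBridge_iff] at hbridge
  have huA : v ∉ A := fun hvA => Set.disjoint_left.mp hdisj hvA hv
  have hvB : u ∉ B := Set.disjoint_left.mp hdisj hu
  let fA : G.induce A →g G.deleteEdges {s(u, v)} := ⟨Subtype.val, fun {a b} hab => by
    refine SimpleGraph.deleteEdges_adj.mpr ⟨hab, fun heq => ?_⟩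
    rcases Sym2.eq_iff.mp heq with ⟨-, h₂⟩ | ⟨h₁, -⟩
    exacts [huA (h₂ ▸ b.2), huA (h₁ ▸ a.2)]⟩
  let fB : G.induce B →g G.deleteEdges {s(u, v)} := ⟨Subtype.val, fun {a b} hab => by
    refine SimpleGraph.deleteEdges_adj.mpr ⟨hab, fun heq => ?_⟩
    rcases Sym2.eq_iff.mp heq with ⟨h₁, -⟩ | ⟨-, h₂⟩
    exacts [hvB (h₁ ▸ a.2), hvB (h₂ ▸ b.2)]⟩
  have h₁ : (G.deleteEdges {s(u, v)}).Reachable u u' :=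
    (hA.preconnected ⟨u, hu⟩ ⟨u', hu'⟩).map fA
  have h₂ : (G.deleteEdges {s(u, v)}).Reachable v' v :=
    (hB.preconnected ⟨v', hv'⟩ ⟨v, hv⟩).map fB
  have h₃ : (G.deleteEdges {s(u, v)}).Adj u' v' :=
    SimpleGraph.deleteEdges_adj.mpr ⟨h', fun heq => hne (Set.mem_singleton_iff.mp heq).symm⟩
  exact hbridge (h₁.trans (h₃.reachable.trans h₂))

theorem Fin.rel_of_forall_rel_succ {α : Type*} {R : α → α → Prop} (hrefl : ∀ x, R x x)
    (htrans : ∀ x y z, R x y → R y z → R x z) {m : ℕ} (f : Fin (m + 1) → α) {a b : Fin (m + 1)}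
    (hab : a ≤ b)
    (hstep : ∀ j : Fin m, a ≤ j.castSucc → j.succ ≤ b → R (f j.castSucc) (f j.succ)) :
    R (f a) (f b) := by
  induction b using Fin.induction with
  | zero =>
    rw [Fin.le_zero_iff.mp hab]
    exact hrefl _
  | succ j ih =>
    rcases hab.eq_or_lt with rfl | hlt
    · exact hrefl _
    · have haj : a ≤ j.castSucc := Fin.le_castSucc_iff.mpr hlt
      exact htrans _ _ _
        (ih haj fun j' h h' => hstep j' h (h'.trans (Fin.castSucc_lt_succ).le))
        (hstep j haj le_rfl)

/-! ### Independent operations and monotonicity along the chain. -/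

namespace GaussianTree

open Matrix

variable {V : Type*}

variable {m : ℕ} {T : Fin (m + 1) → GaussianTree V} {i p q : Fin m → V}
  {part : V → Option (Fin m)}

/-- The edge between a super leaf node and the rest of the tree is unique. -/
theorem IsStarGrouping.eq_of_adj (hstar : IsStarGrouping T i p q part) (t : Fin (m + 1))
    {k : Fin m} {u v u' v' : V} (h : (T t).graph.Adj u v) (h' : (T t).graph.Adj u' v')
    (hu : part u = some k) (hv : part v ≠ some k) (hu' : part u' = some k)
    (hv' : part v' ≠ some k) : u = u' ∧ v = v' := by
  have hnone : ∀ {a b}, (T t).graph.Adj a b → part a = some k → part b ≠ some k →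
      part b = none := by
    intro a b hab ha hb
    rcases hstar.star t a b hab with h | h | h
    · exact absurd (h.symm.trans ha) hb
    · rw [ha] at h
      cases h
    · exact h
  have hdisj : Disjoint {v | part v = some k} {v | part v = none} := by
    rw [Set.disjoint_left]
    intro x hx hx'
    rw [Set.mem_ofPred_eq] at hx hx'
    rw [hx] at hx'
    cases hx'
  have heq := (T t).isTree.isAcyclic.eq_of_adj_of_connected hdisj (hstar.connected t (some k))
    (hstar.connected t none) hu (hnone h hu hv) hu' (hnone h' hu' hv') h h'
  rcases Sym2.eq_iff.mp heq with h | h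
  · exact h
  · exact absurd (h.2 ▸ hu') hv

/-- Otherwise two edges would join the super leaf node to the center. Hence the new edge has weight
zero before the operation. -/
theorem IsStarGrouping.not_adj (hstar : IsStarGrouping T i p q part)
    (hchain : IsGraftingChain T i p q) (k : Fin m) :
    ¬ (T k.castSucc).graph.Adj (i k) (q k) := by
  intro hadj
  have hg := hchain k
  rcases hstar.anchors k with ⟨hi, hp, hq⟩ | ⟨hi, hp, hq⟩
  · exact hg.ne (hstar.eq_of_adj _ hadj hg.adj hi (by simp [hq]) hi (by simp [hp])).2
  · exact hg.ne (hstar.eq_of_adj _ hadj.symm hg.adj.symm hq (by simp [hi]) hp (by simp [hi])).1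

/-- The ends of the two edges of an operation, the end in the super leaf node first. -/
theorem IsStarGrouping.exists_ends (hstar : IsStarGrouping T i p q part)
    (hchain : IsGraftingChain T i p q) (k : Fin m) : ∃ r s r' s' : V,
    s(i k, p k) = s(r, s) ∧ s(i k, q k) = s(r', s') ∧
      part r = some k ∧ part s ≠ some k ∧ part r' = some k ∧ part s' ≠ some k ∧
      (T k.castSucc).graph.Adj r s ∧ (T k.succ).graph.Adj r' s' := by
  have hg := hchain k
  rcases hstar.anchors k with ⟨hi, hp, hq⟩ | ⟨hi, hp, hq⟩
  · exact ⟨i k, p k, i k, q k, rfl, rfl, hi, by simp [hp], hi, by simp [hq], hg.adj, hg.adj'⟩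
  · exact ⟨p k, i k, q k, i k, Sym2.eq_swap, Sym2.eq_swap, hp, by simp [hi], hq, by simp [hi],
      hg.adj.symm, hg.adj'.symm⟩

variable [DecidableEq V]

theorem IsGrafting.edgeWeight_eq {T T' : GaussianTree V} {i p q : V} (h : IsGrafting T T' i p q) :
    T'.edgeWeight = Function.update (Function.update T.edgeWeight s(i, p) 0) s(i, q)
      (T.weight s(i, p)) := by
  ext e
  by_cases heq : e = s(i, q)
  · subst heq
    rw [Function.update_self, T'.edgeWeight_of_adj h.adj', h.weight_new]
  rw [Function.update_of_ne heq]
  by_cases hep : e = s(i, p)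
  · subst hep
    rw [Function.update_self, edgeWeight_of_notMem]
    rw [h.edgeSet_eq]
    simpa using heq
  rw [Function.update_of_ne hep]
  by_cases he : e ∈ T.graph.edgeSet
  · have he' : e ∈ T'.graph.edgeSet := by
      rw [h.edgeSet_eq]
      exact .inl ⟨he, hep⟩
    rw [T.edgeWeight_of_mem he, T'.edgeWeight_of_mem he', h.weight_old e he hep]
  · have he' : e ∉ T'.graph.edgeSet := by
      rw [h.edgeSet_eq]
      rintro (h | h)
      exacts [he h.1, heq h]
    rw [T.edgeWeight_of_notMem he, T'.edgeWeight_of_notMem he']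

theorem IsGraftingChain.edgeWeight_succ (hchain : IsGraftingChain T i p q) (k : Fin m) :
    (T k.succ).edgeWeight = Function.update
      (Function.update (T k.castSucc).edgeWeight s(i k, p k) 0) s(i k, q k)
      ((T k.castSucc).weight s(i k, p k)) :=
  (hchain k).edgeWeight_eq

/-- Operations other than the `k`-th one do not change the weights at the `k`-th super leaf
node. -/
theorem IsStarGrouping.edgeWeight_eq_of_ne (hstar : IsStarGrouping T i p q part)
    (hchain : IsGraftingChain T i p q) {j k : Fin m} (hjk : j ≠ k) {u : V}
    (hu : part u = some k) (v : V) :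
    (T j.castSucc).edgeWeight s(u, v) = (T j.succ).edgeWeight s(u, v) := by
  have hne : ∀ x, part x = none ∨ part x = some j → u ≠ x := by
    rintro x hx rfl
    rcases hx with hx | hx <;> rw [hu] at hx
    · cases hx
    · exact hjk (Option.some.inj hx).symm
  have hedge : ∀ x y, (part x = none ∨ part x = some j) → (part y = none ∨ part y = some j) →
      s(u, v) ≠ s(x, y) := by
    intro x y hx hy h
    rcases Sym2.eq_iff.mp h with h | h
    exacts [hne x hx h.1, hne y hy h.1]
  have hparts : (part (i j) = none ∨ part (i j) = some j) ∧
      (part (p j) = none ∨ part (p j) = some j) ∧ (part (q j) = none ∨ part (q j) = some j) := by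
    rcases hstar.anchors j with h | h <;> simp [h]
  rw [hchain.edgeWeight_succ j, Function.update_of_ne (hedge _ _ hparts.1 hparts.2.2),
    Function.update_of_ne (hedge _ _ hparts.1 hparts.2.1)]

theorem IsStarGrouping.edgeWeight_eq_of_le (hstar : IsStarGrouping T i p q part)
    (hchain : IsGraftingChain T i p q) {k : Fin m} {a b : Fin (m + 1)} (hab : a ≤ b)
    (hk : b ≤ k.castSucc ∨ k.succ ≤ a) {u : V} (hu : part u = some k) (v : V) :
    (T a).edgeWeight s(u, v) = (T b).edgeWeight s(u, v) := by
  refine Fin.rel_of_forall_rel_succ (R := Eq) (fun _ => rfl) (fun _ _ _ => Eq.trans)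
    (fun t => (T t).edgeWeight s(u, v)) hab fun j haj hjb => ?_
  refine hstar.edgeWeight_eq_of_ne hchain ?_ hu v
  rintro rfl
  rcases hk with hk | hk
  · exact absurd (hjb.trans hk) (not_le.mpr Fin.castSucc_lt_succ)
  · exact absurd (hk.trans haj) (not_le.mpr Fin.castSucc_lt_succ)

variable [Fintype V]

/-- A single operation keeps the determinant, and it increases the determinants of the mixtures with
the trees on the other side of it. -/
theorem IsStarGrouping.det_mixture_le (hstar : IsStarGrouping T i p q part)
    (hchain : IsGraftingChain T i p q) (k : Fin m) :
    (info (T k.castSucc).edgeWeight).det = (info (T k.succ).edgeWeight).det ∧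
    (∀ t ≤ k.castSucc, ∀ l ∈ Set.Icc (0 : ℝ) 1,
      (l • info (T t).edgeWeight + (1 - l) • info (T k.castSucc).edgeWeight).det ≤
        (l • info (T t).edgeWeight + (1 - l) • info (T k.succ).edgeWeight).det) ∧
    (∀ t, k.succ ≤ t → ∀ l ∈ Set.Icc (0 : ℝ) 1,
      (l • info (T t).edgeWeight + (1 - l) • info (T k.succ).edgeWeight).det ≤
        (l • info (T t).edgeWeight + (1 - l) • info (T k.castSucc).edgeWeight).det) := by
  obtain ⟨r, s, r', s', he, he', hr, hs, hr', hs', hadj, hadj'⟩ := hstar.exists_ends hchain k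
  have hsucc := hchain.edgeWeight_succ k
  rw [he, he'] at hsucc
  set w := (T k.castSucc).weight s(r, s)
  have hw : |w| < 1 := (T k.castSucc).abs_weight_lt_one s(r, s) hadj
  have hnot : (T k.castSucc).edgeWeight s(r', s') = 0 := by
    rw [← he']
    exact edgeWeight_of_not_adj _ (hstar.not_adj hchain k)
  have hwk : (T k.castSucc).edgeWeight s(r, s) = w := edgeWeight_of_adj _ hadj
  have hwk' : (T k.succ).edgeWeight s(r', s') = w := by rw [hsucc, Function.update_self]
  set ρ := Function.update (T k.castSucc).edgeWeight s(r, s) 0 with hρdef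
  have h₀ : ρ s(r, s) = 0 := Function.update_self ..
  have h₀' : ρ s(r', s') = 0 := by
    by_cases h : s(r', s') = s(r, s)
    · rw [h, h₀]
    · rw [hρdef, Function.update_of_ne h, hnot]
  -- Cutting the old edge before the operation and the new edge after it leaves the same weights, so
  -- z and z' refer to one matrix.
  have hρ' : Function.update (T k.succ).edgeWeight s(r', s') 0 = ρ := by
    rw [hsucc, Function.update_idem, Function.update_eq_self_iff, h₀']
  have hcast : Function.update ρ s(r, s) w = (T k.castSucc).edgeWeight := by
    rw [Function.update_idem, Function.update_eq_self_iff, hwk]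
  set L : Set V := {v | part v = some k}
  have hρpos : (info ρ).PosDef := posDef_info_update_zero _ _
  obtain ⟨z, hzL, hzr, hz⟩ := (T k.castSucc).exists_column_of_cut (L := L) hr hs hadj
    fun u v h hu hv => hstar.eq_of_adj _ h hadj hu hv hr hs
  obtain ⟨z', hzL', hzr', hz'⟩ := (T k.succ).exists_column_of_cut (L := L) hr' hs' hadj'
    fun u v h hu hv => hstar.eq_of_adj _ h hadj' hu hv hr' hs'
  rw [hρ'] at hz'
  refine ⟨?_, fun t ht l hl => ?_, fun t ht l hl => ?_⟩
  · have hrs : r ≠ s := fun h => hs (h ▸ hr)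
    have hrs' : r' ≠ s' := fun h => hs' (h ▸ hr')
    rw [← hcast, hsucc, info_update hrs h₀, info_update hrs' h₀',
      det_add_edgeMatrix hρpos hz hzr (hzL s hs) hw,
      det_add_edgeMatrix hρpos hz' hzr' (hzL' s' hs') hw]
  · have hagree : ∀ u ∈ L, ∀ v, (T t).edgeWeight s(u, v) = (T k.castSucc).edgeWeight s(u, v) :=
      fun u hu v => hstar.edgeWeight_eq_of_le hchain ht (.inl le_rfl) hu v
    have ht' : Function.update (Function.update (T t).edgeWeight s(r, s) 0) s(r, s) w =
        (T t).edgeWeight := by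
      rw [Function.update_idem, Function.update_eq_self_iff, hagree r hr s, hwk]
    -- Before step k, `T t` agrees with `T k.castSucc` at L, so it carries the old edge with the
    -- same weight.
    have key := det_mixture_le_of_move ((T t).posDef_info_update_zero s(r, s)) hρpos
      (fun u hu v => by
        rw [hρdef, Function.update_apply, Function.update_apply, hagree u hu v])
      (fun _ _ _ => rfl) hr hs hr' hs' hzL hzr hz hzL' hzr' hz' h₀ h₀' hw hl
    rwa [ht', hcast, ← hsucc] at key
  · have hagree : ∀ u ∈ L, ∀ v, (T t).edgeWeight s(u, v) = (T k.succ).edgeWeight s(u, v) :=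
      fun u hu v => (hstar.edgeWeight_eq_of_le hchain ht (.inr le_rfl) hu v).symm
    have ht' : Function.update (Function.update (T t).edgeWeight s(r', s') 0) s(r', s') w =
        (T t).edgeWeight := by
      rw [Function.update_idem, Function.update_eq_self_iff, hagree r' hr' s', hwk']
    -- After step k, `T t` carries the new edge, so the two edges exchange roles.
    have key := det_mixture_le_of_move ((T t).posDef_info_update_zero s(r', s')) hρpos
      (fun u hu v => by
        rw [← hρ', Function.update_apply, Function.update_apply, hagree u hu v])
      (fun _ _ _ => rfl) hr' hs' hr hs hzL' hzr' hz' hzL hzr hz h₀' h₀ hw hl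
    rwa [ht', hcast, ← hsucc] at key

theorem IsStarGrouping.det_info_eq (hstar : IsStarGrouping T i p q part)
    (hchain : IsGraftingChain T i p q) (a b : Fin (m + 1)) :
    (info (T a).edgeWeight).det = (info (T b).edgeWeight).det := by
  have h : ∀ a, (info (T 0).edgeWeight).det = (info (T a).edgeWeight).det := fun a =>
    Fin.rel_of_forall_rel_succ (R := Eq) (fun _ => rfl) (fun _ _ _ => Eq.trans)
      (fun t => (info (T t).edgeWeight).det) (Fin.zero_le a)
      fun j _ _ => (hstar.det_mixture_le hchain j).1
  exact (h a).symm.trans (h b)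

theorem IsStarGrouping.det_mixture_mono (hstar : IsStarGrouping T i p q part)
    (hchain : IsGraftingChain T i p q) {a b c d : Fin (m + 1)} (hab : a ≤ b) (hbc : b ≤ c)
    (hcd : c ≤ d) {l : ℝ} (hl : l ∈ Set.Icc (0 : ℝ) 1) :
    (l • info (T b).edgeWeight + (1 - l) • info (T c).edgeWeight).det ≤
      (l • info (T a).edgeWeight + (1 - l) • info (T d).edgeWeight).det := by
  have hright : (l • info (T b).edgeWeight + (1 - l) • info (T c).edgeWeight).det ≤
      (l • info (T b).edgeWeight + (1 - l) • info (T d).edgeWeight).det :=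
    Fin.rel_of_forall_rel_succ (R := (· ≤ ·)) le_refl (fun _ _ _ => le_trans)
      (fun t => (l • info (T b).edgeWeight + (1 - l) • info (T t).edgeWeight).det) hcd
      fun j hcj _ => (hstar.det_mixture_le hchain j).2.1 b (hbc.trans hcj) l hl
  refine hright.trans ?_
  -- Now the left tree moves outward. `det_mixture_le` has the moving tree in the second slot, hence
  -- the parameter 1 - l.
  refine Fin.rel_of_forall_rel_succ (R := (· ≥ ·)) le_refl (fun _ _ _ => ge_trans)
    (fun t => (l • info (T t).edgeWeight + (1 - l) • info (T d).edgeWeight).det) hab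
    fun j _ hjb => ?_
  have h := (hstar.det_mixture_le hchain j).2.2 d (hjb.trans (hbc.trans hcd)) (1 - l)
    ⟨by linarith [hl.2], by linarith [hl.1]⟩
  rw [sub_sub_cancel] at h
  simpa only [add_comm] using h

theorem IsStarGrouping.CI_mono (hstar : IsStarGrouping T i p q part)
    (hchain : IsGraftingChain T i p q) {a b c d : Fin (m + 1)} (hab : a ≤ b) (hbc : b ≤ c)
    (hcd : c ≤ d) : CI (T b) (T c) ≤ CI (T a) (T d) := by
  have hdet : ∀ s t, (T s).cov.det = (T t).cov.det := by
    intro s t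
    rw [cov_eq_inv_info, cov_eq_inv_info, det_nonsing_inv, det_nonsing_inv,
      hstar.det_info_eq hchain s t]
  refine Gaussian.chernoffInfo_mono (cov_posDef _) (cov_posDef _) (cov_posDef _) (cov_posDef _)
    (hdet _ _) (hdet _ _) fun l hl => ?_
  simp only [inv_cov]
  exact hstar.det_mixture_mono hchain hab hbc hcd hl

theorem CI_comm (T T' : GaussianTree V) : CI T T' = CI T' T :=
  Gaussian.chernoffInfo_comm T.cov_posDef T'.cov_posDef

end GaussianTree

/-- Along a grafting chain `T 0 ↔ ⋯ ↔ T m` with independent operations the Chernoff information is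
monotone in the pair, so the minimum over all pairs is attained at an adjacent pair. -/
theorem proposition6 {V : Type*} [Fintype V] [DecidableEq V] {m : ℕ}
    (T : Fin (m + 1) → GaussianTree V) (i p q : Fin m → V)
    (hchain : GaussianTree.IsGraftingChain T i p q)
    (hindep : GaussianTree.IsIndependent T i p q) :
    (∀ a b c d : Fin (m + 1), a ≤ b → b ≤ c → c ≤ d →
      GaussianTree.CI (T b) (T c) ≤ GaussianTree.CI (T a) (T d)) ∧
    (0 < m → ∃ k : Fin m, ∀ a b : Fin (m + 1), a ≠ b →
      GaussianTree.CI (T k.castSucc) (T k.succ) ≤ GaussianTree.CI (T a) (T b)) := by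
  obtain ⟨part, hstar⟩ := hindep
  refine ⟨fun a b c d hab hbc hcd => hstar.CI_mono hchain hab hbc hcd, fun hm => ?_⟩
  have : Nonempty (Fin m) := ⟨⟨0, hm⟩⟩
  obtain ⟨k, hk⟩ := Finite.exists_min fun k : Fin m =>
    GaussianTree.CI (T k.castSucc) (T k.succ)
  have hlt : ∀ a b : Fin (m + 1), a < b →
      GaussianTree.CI (T k.castSucc) (T k.succ) ≤ GaussianTree.CI (T a) (T b) := by
    intro a b hab
    -- The adjacent pair starting at a lies inside the interval from a to b.
    obtain ⟨j, rfl⟩ := Fin.exists_castSucc_eq.mpr (Fin.ne_last_of_lt hab)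
    exact (hk j).trans (hstar.CI_mono hchain le_rfl Fin.castSucc_lt_succ.le
      (Fin.castSucc_lt_iff_succ_le.mp hab))
  refine ⟨k, fun a b hab => ?_⟩
  rcases hab.lt_or_gt with h | h
  · exact hlt a b h
  · rw [GaussianTree.CI_comm (T a)]
    exact hlt b a h
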